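/- **Theorem (Decidability).** Let $0<p\le\infty$. On $[0,\infty]$ let $a\otimes b$ be multiplication with $0\otimes\infty=0$, let $a^*=1/a$ (with $0^*=\infty$, $\infty^*=0$), $a\otimes^* b=(a^*\otimes b^*)^*$, $a\oplus_p b=(a^p+b^p)^{1/p}$ and $a\oplus^*_p b=(a^*\oplus_p b^*)^*$ for $p<\infty$, and $a\oplus_\infty b=\max(a,b)$, $a\oplus^*_\infty b=\min(a,b)$. Let $V$ be a set. *Formulae* over $V$ are given by $A::= a\mid a^\perp\mid \mathbf 1\mid A\otimes A\mid A⅋A\mid \bot\mid\top\mid A\vee A\mid A\wedge A$ with $a\in V$; negation $(-)^\perp$ is the syntactic operation that exchanges $a$ and $a^\perp$, $\bot$ and $\top$, fixes $\mathbf 1$, and exchanges $\otimes$ with $⅋$ and $\vee$ with $\wedge$ while negating the two arguments. A *sequent* $\Gamma\vdash\Delta$ is a pair of finite multisets of formulae. *Structures* are the formal expressions built from sequents and elements of $[0,\infty]$ with the four binary connectives $\otimes,\otimes^*,\oplus_p,\oplus^*_p$; a structure without sequents is *closed*, and has a value in $[0,\infty]$. The rules of pQLL (premise structure $\Rightarrow$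 conclusion), for all formulae $A,B$ and multisets $\Gamma,\Gamma',\Delta,\Delta'$, are: - structural: $1\Rightarrow(A\vdash A)$; $1\Rightarrow(\,\vdash\,)$; $0\Rightarrow(\Gamma\vdash\Delta)$; cut: $(\Gamma\vdash A,\Delta)\otimes(\Gamma',A\vdash\Delta')\Rightarrow(\Gamma,\Gamma'\vdash\Delta,\Delta')$; mix: $(\Gamma\vdash\Delta)\otimes(\Gamma'\vdash\Delta')\Rightarrow(\Gamma,\Gamma'\vdash\Delta,\Delta')$; - multiplicative: $(\Gamma,A,B\vdash\Delta)\Rightarrow(\Gamma,A\otimes B\vdash\Delta)$; $(\Gamma\vdash A,B,\Delta)\Rightarrow(\Gamma\vdash A⅋B,\Delta)$; $(\Gamma,A\vdash\Delta)\otimes(\Gamma',B\vdash\Delta')\Rightarrow(\Gamma,\Gamma',A⅋B\vdash\Delta,\Delta')$; $(\Gamma\vdash A,\Delta)\otimes(\Gamma'\vdash B,\Delta')\Rightarrow(\Gamma,\Gamma'\vdash A\otimes B,\Delta,\Delta')$; $1\Rightarrow(\mathbf 1\vdash\,)$; $1\Rightarrow(\,\vdash\mathbf 1)$; $(\Gamma\vdash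 A,\Delta)\Rightarrow(\Gamma,A^\perp\vdash\Delta)$; $(\Gamma,A\vdash\Delta)\Rightarrow(\Gamma\vdash A^\perp,\Delta)$; - additive: $(\Gamma,A\vdash\Delta)\oplus^*_p(\Gamma,B\vdash\Delta)\Rightarrow(\Gamma,A\vee B\vdash\Delta)$; $(\Gamma\vdash A,\Delta)\oplus^*_p(\Gamma\vdash B,\Delta)\Rightarrow(\Gamma\vdash A\wedge B,\Delta)$; $(\Gamma,A\vdash\Delta)\oplus_p(\Gamma,B\vdash\Delta)\Rightarrow(\Gamma,A\wedge B\vdash\Delta)$; $(\Gamma\vdash A,\Delta)\oplus_p(\Gamma\vdash B,\Delta)\Rightarrow(\Gamma\vdash A\vee B,\Delta)$; $\infty\Rightarrow(\Gamma,\bot\vdash\Delta)$; $\infty\Rightarrow(\Gamma\vdash\top,\Delta)$. *Derivations* from one structure to another are generated by identities, instances of rules, vertical composition, and the combination of two derivations side by side by any of the four connectives. A *proof* of $\Gamma\vdash\Delta$ is a derivation from a closed structure to $\Gamma\vdash\Delta$; its *validity* is the value of that closed structure. The *provability* of $\Gamma\vdash\Delta$ is the supremum in $[0,\infty]$ of the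 validities of its proofs. Then for every sequent $\Gamma\vdash\Delta$ the supremum defining its provability is a maximum: there is a proof of $\Gamma\vdash\Delta$ in pQLL whose validity equals the provability of $\Gamma\vdash\Delta$. -/

import Mathlib

open scoped ENNReal

namespace QLL

universe u

/-! ### The extended positive reals

Conjunctive multiplication is the multiplication of `ℝ≥0∞` (where `0 * ∞ = 0`), and duality is the
inversion of `ℝ≥0∞` (where `0⁻¹ = ∞` and `∞⁻¹ = 0`). -/

noncomputable section

/-- Disjunctive multiplication, the De Morgan dual of multiplication (so that it sends
`0` and `∞` to `∞`). -/
def parMul (a b : ℝ≥0∞) : ℝ≥0∞ := (a⁻¹ * b⁻¹)⁻¹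

/-- Harmonic sum, the De Morgan dual of addition. -/
def hadd (a b : ℝ≥0∞) : ℝ≥0∞ := (a⁻¹ + b⁻¹)⁻¹

/-- The `p`-sum, which is the maximum for `p = ∞`. -/
def padd (p a b : ℝ≥0∞) : ℝ≥0∞ :=
  if p = ∞ then max a b else (a ^ p.toReal + b ^ p.toReal) ^ (1 / p.toReal)

/-- The harmonic `p`-sum, which is the minimum for `p = ∞`. -/
def pcoadd (p a b : ℝ≥0∞) : ℝ≥0∞ :=
  if p = ∞ then min a b else (hadd (a ^ p.toReal) (b ^ p.toReal)) ^ (1 / p.toReal)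

end

/-! ### Quantitative calculi -/

/-- The four (alethic) connectives that combine sequents into structures. -/
inductive Conn where
  | tensor
  | par
  | padd
  | pcoadd

/-- The operation on `[0,∞]` that a connective stands for, at hardness `p`. -/
noncomputable def Conn.interp (p : ℝ≥0∞) : Conn → ℝ≥0∞ → ℝ≥0∞ → ℝ≥0∞
  | .tensor => fun a b => a * b
  | .par => parMul
  | .padd => QLL.padd p
  | .pcoadd => QLL.pcoadd p

/-- A sequent: two finite multisets of formulae. -/
structure Sequent (Φ : Type u) : Type u where
  ant : Multiset Φ
  succ : Multiset Φ

/-- Structures of sequents: syntactic expressions built from sequents and elements of `[0,∞]`. -/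
inductive Structure (Φ : Type u) : Type u where
  | seq (s : Sequent Φ) : Structure Φ
  | val (r : ℝ≥0∞) : Structure Φ
  | op (c : Conn) (H K : Structure Φ) : Structure Φ

/-- A structure is closed if no sequent occurs in it. -/
def Structure.IsClosed {Φ : Type u} : Structure Φ → Prop
  | .seq _ => False
  | .val _ => True
  | .op _ H K => H.IsClosed ∧ K.IsClosed

/-- The value of a closed structure at hardness `p`. -/
noncomputable def Structure.eval {Φ : Type u} (p : ℝ≥0∞) :
    (H : Structure Φ) → H.IsClosed → ℝ≥0∞
  | .seq _, h => False.elim h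
  | .val r, _ => r
  | .op c H K, h => c.interp p (H.eval p h.1) (K.eval p h.2)

/-- A calculus is a family of rules; `R H K` is the type of the instances of rules with
premise structure `H` and conclusion structure `K`. -/
abbrev Calculus (Φ : Type u) : Type (u + 1) := Structure Φ → Structure Φ → Type u

/-- Derivations, from a top structure to a bottom structure. -/
inductive Derivation {Φ : Type u} (R : Calculus Φ) : Structure Φ → Structure Φ → Type u where
  | id (H : Structure Φ) : Derivation R H H
  | rule {H K : Structure Φ} (r : R H K) : Derivation R H K
  | comp {H I K : Structure Φ} (d₁ : Derivation R H I) (d₂ : Derivation R I K) : Derivation R H K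
  | op (c : Conn) {H₁ K₁ H₂ K₂ : Structure Φ}
      (d₁ : Derivation R H₁ K₁) (d₂ : Derivation R H₂ K₂) :
      Derivation R (.op c H₁ H₂) (.op c K₁ K₂)

/-- A closed derivation of `K`: a derivation of `K` with closed top structure. -/
structure ClosedDerivation {Φ : Type u} (R : Calculus Φ) (K : Structure Φ) : Type u where
  top : Structure Φ
  closed : top.IsClosed
  derivation : Derivation R top K

/-- The validity of a closed derivation is the value of its top structure. -/
noncomputable def ClosedDerivation.validity {Φ : Type u} {R : Calculus Φ} {K : Structure Φ}
    (p : ℝ≥0∞) (d : ClosedDerivation R K) : ℝ≥0∞ :=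
  d.top.eval p d.closed

/-- A proof of a sequent is a closed derivation of it. -/
abbrev Proof {Φ : Type u} (R : Calculus Φ) (s : Sequent Φ) : Type u := ClosedDerivation R (.seq s)

/-- The provability of a sequent is the supremum of the validities of its proofs. -/
noncomputable def provability {Φ : Type u} (p : ℝ≥0∞) (R : Calculus Φ) (s : Sequent Φ) : ℝ≥0∞ :=
  ⨆ π : Proof R s, π.validity p

/-! ### Formulae of quantitative linear logic -/

/-- Formulae over the set `V` of propositional variables. `bot`, `top`, `por`, `pand` are the
additive units, the soft disjunction and the soft conjunction. -/
inductive Formula (V : Type u) : Type u where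
  | atom (a : V) : Formula V
  | natom (a : V) : Formula V
  | one : Formula V
  | tensor (A B : Formula V) : Formula V
  | par (A B : Formula V) : Formula V
  | bot : Formula V
  | top : Formula V
  | por (A B : Formula V) : Formula V
  | pand (A B : Formula V) : Formula V

/-- Negation, a syntactic operation on formulae. -/
def Formula.neg {V : Type u} : Formula V → Formula V
  | .atom a => .natom a
  | .natom a => .atom a
  | .one => .one
  | .tensor A B => .par A.neg B.neg
  | .par A B => .tensor A.neg B.neg
  | .bot => .top
  | .top => .bot
  | .por A B => .pand A.neg B.neg
  | .pand A B => .por A.neg B.neg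

/-! ### The rules -/

/-- The unary structure made of the sequent with the two given cedents. -/
notation:50 Γ:51 " ⊢ₛ " Δ:51 => Structure.seq (Sequent.mk Γ Δ)

infix:45 " ⊗ₛ " => Structure.op Conn.tensor

infix:45 " ⊕ₛ " => Structure.op Conn.padd

infix:45 " ⊓ₛ " => Structure.op Conn.pcoadd

/-- The rules of quantitative linear logic: `PQLL V H K` is the type of rule instances with premise
structure `H` and conclusion structure `K`. The hardness `p` enters only through the values of the
connectives `⊕ₛ` and `⊓ₛ`, the `p`-sum and the harmonic `p`-sum. -/
inductive PQLL (V : Type u) : Calculus (Formula V) where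
  -- structural rules
  | ax (A : Formula V) : PQLL V (.val 1) ({A} ⊢ₛ {A})
  | emp : PQLL V (.val 1) (0 ⊢ₛ 0)
  | efq (Γ Δ : Multiset (Formula V)) : PQLL V (.val 0) (Γ ⊢ₛ Δ)
  | cut (Γ Γ' Δ Δ' : Multiset (Formula V)) (A : Formula V) :
      PQLL V ((Γ ⊢ₛ A ::ₘ Δ) ⊗ₛ (A ::ₘ Γ' ⊢ₛ Δ')) (Γ + Γ' ⊢ₛ Δ + Δ')
  | mix (Γ Γ' Δ Δ' : Multiset (Formula V)) :
      PQLL V ((Γ ⊢ₛ Δ) ⊗ₛ (Γ' ⊢ₛ Δ')) (Γ + Γ' ⊢ₛ Δ + Δ')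
  -- multiplicative rules
  | tensorL (Γ Δ : Multiset (Formula V)) (A B : Formula V) :
      PQLL V (A ::ₘ B ::ₘ Γ ⊢ₛ Δ) (.tensor A B ::ₘ Γ ⊢ₛ Δ)
  | parR (Γ Δ : Multiset (Formula V)) (A B : Formula V) :
      PQLL V (Γ ⊢ₛ A ::ₘ B ::ₘ Δ) (Γ ⊢ₛ .par A B ::ₘ Δ)
  | parL (Γ Γ' Δ Δ' : Multiset (Formula V)) (A B : Formula V) :
      PQLL V ((A ::ₘ Γ ⊢ₛ Δ) ⊗ₛ (B ::ₘ Γ' ⊢ₛ Δ')) (.par A B ::ₘ (Γ + Γ') ⊢ₛ Δ + Δ')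
  | tensorR (Γ Γ' Δ Δ' : Multiset (Formula V)) (A B : Formula V) :
      PQLL V ((Γ ⊢ₛ A ::ₘ Δ) ⊗ₛ (Γ' ⊢ₛ B ::ₘ Δ')) (Γ + Γ' ⊢ₛ .tensor A B ::ₘ (Δ + Δ'))
  | oneL : PQLL V (.val 1) ({.one} ⊢ₛ 0)
  | oneR : PQLL V (.val 1) (0 ⊢ₛ {.one})
  | negL (Γ Δ : Multiset (Formula V)) (A : Formula V) :
      PQLL V (Γ ⊢ₛ A ::ₘ Δ) (A.neg ::ₘ Γ ⊢ₛ Δ)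
  | negR (Γ Δ : Multiset (Formula V)) (A : Formula V) :
      PQLL V (A ::ₘ Γ ⊢ₛ Δ) (Γ ⊢ₛ A.neg ::ₘ Δ)
  -- additive rules
  | porL (Γ Δ : Multiset (Formula V)) (A B : Formula V) :
      PQLL V ((A ::ₘ Γ ⊢ₛ Δ) ⊓ₛ (B ::ₘ Γ ⊢ₛ Δ)) (.por A B ::ₘ Γ ⊢ₛ Δ)
  | pandR (Γ Δ : Multiset (Formula V)) (A B : Formula V) :
      PQLL V ((Γ ⊢ₛ A ::ₘ Δ) ⊓ₛ (Γ ⊢ₛ B ::ₘ Δ)) (Γ ⊢ₛ .pand A B ::ₘ Δ)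
  | pandL (Γ Δ : Multiset (Formula V)) (A B : Formula V) :
      PQLL V ((A ::ₘ Γ ⊢ₛ Δ) ⊕ₛ (B ::ₘ Γ ⊢ₛ Δ)) (.pand A B ::ₘ Γ ⊢ₛ Δ)
  | porR (Γ Δ : Multiset (Formula V)) (A B : Formula V) :
      PQLL V ((Γ ⊢ₛ A ::ₘ Δ) ⊕ₛ (Γ ⊢ₛ B ::ₘ Δ)) (Γ ⊢ₛ .por A B ::ₘ Δ)
  | botL (Γ Δ : Multiset (Formula V)) : PQLL V (.val ∞) (.bot ::ₘ Γ ⊢ₛ Δ)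
  | topR (Γ Δ : Multiset (Formula V)) : PQLL V (.val ∞) (Γ ⊢ₛ .top ::ₘ Δ)

end QLL

namespace QLL

open Multiset

universe u

variable {V : Type u} {p : ℝ≥0∞}

/-! ### Arithmetic of the soft sums -/

section Arithmetic

variable {a b c d : ℝ≥0∞}

/-! Quantitative cut elimination combined with finiteness of cut-free proof search. Moving
antecedents to the right by negation turns sequents into one-sided ones, for which `CutFree` is a
calculus without cut.

Cut is admissible there without loss of validity (`Attains.cut`). When the cut formula is
multiplicative, the validities merely get reassociated. When it is additive, the point is that a
p-sum times a harmonic p-sum is at most the larger of the two products of matching components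
(`padd_mul_pcoadd_le`), so a single smaller cut suffices. Hence each proof, whatever cuts it
contains, is dominated by a cut-free one (`ClosedDerivation.attains`).

Read backwards, cut-free rules only shrink the sequent, so its cut-free proofs have finitely many
validities (`finite_cutFree`). The largest is realised by a genuine proof of the same validity
(`HasProof.of_cutFree`, `HasProof.of_oneSided`) and bounds all the others. -/

lemma hadd_mono (hac : a ≤ c) (hbd : b ≤ d) : hadd a b ≤ hadd c d := by
  unfold hadd
  gcongr

lemma padd_mono (hac : a ≤ c) (hbd : b ≤ d) : padd p a b ≤ padd p c d := by
  unfold padd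
  split_ifs
  · exact max_le_max hac hbd
  · gcongr

lemma pcoadd_mono (hac : a ≤ c) (hbd : b ≤ d) : pcoadd p a b ≤ pcoadd p c d := by
  unfold pcoadd
  split_ifs
  · exact min_le_min hac hbd
  · exact ENNReal.rpow_le_rpow
      (hadd_mono (ENNReal.rpow_le_rpow hac (by positivity))
        (ENNReal.rpow_le_rpow hbd (by positivity))) (by positivity)

lemma hadd_mul_le : hadd a b * c ≤ hadd (a * c) (b * c) := by
  unfold hadd
  rcases eq_or_ne c 0 with rfl | hc
  · simp
  rcases eq_or_ne a 0 with rfl | ha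
  · simp
  rcases eq_or_ne b 0 with rfl | hb
  · simp
  rcases eq_or_ne c ∞ with rfl | hc'
  · simp [ENNReal.mul_top ha, ENNReal.mul_top hb]
  · rw [ENNReal.mul_inv (Or.inr hc') (Or.inr hc), ENNReal.mul_inv (Or.inr hc') (Or.inr hc),
      ← add_mul, ENNReal.mul_inv (Or.inr (ENNReal.inv_ne_top.2 hc))
        (Or.inr (ENNReal.inv_ne_zero.2 hc')), inv_inv]

/-- For finite nonzero `c` and `d`, the left side is the average of `a * c` and `b * d` with weights
proportional to `c⁻¹` and `d⁻¹`. The degenerate values are treated separately. -/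
lemma add_mul_hadd_le : (a + b) * hadd c d ≤ max (a * c) (b * d) := by
  have key : ∀ x ∈ ({c, d} : Set ℝ≥0∞), hadd c d ≤ x := by
    rintro x (rfl | rfl)
    · exact ENNReal.inv_le_iff_inv_le.2 le_self_add
    · exact ENNReal.inv_le_iff_inv_le.2 le_add_self
  rcases eq_or_ne c 0 with rfl | hc
  · simp [hadd]
  rcases eq_or_ne d 0 with rfl | hd
  · simp [hadd]
  rcases eq_or_ne a 0 with rfl | ha
  · rw [zero_add]
    exact (mul_le_mul' le_rfl (key d (by simp))).trans (le_max_right _ _)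
  rcases eq_or_ne b 0 with rfl | hb
  · rw [add_zero]
    exact (mul_le_mul' le_rfl (key c (by simp))).trans (le_max_left _ _)
  rcases eq_or_ne c ∞ with rfl | hc'
  · simp [ENNReal.mul_top ha]
  rcases eq_or_ne d ∞ with rfl | hd'
  · simp [ENNReal.mul_top hb]
  set m := max (a * c) (b * d) with hm
  have h1 : a ≤ m * c⁻¹ := by
    rw [← div_eq_mul_inv, ENNReal.le_div_iff_mul_le (Or.inl hc) (Or.inl hc')]
    exact le_max_left _ _
  have h2 : b ≤ m * d⁻¹ := by
    rw [← div_eq_mul_inv, ENNReal.le_div_iff_mul_le (Or.inl hd) (Or.inl hd')]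
    exact le_max_right _ _
  calc (a + b) * hadd c d ≤ (m * c⁻¹ + m * d⁻¹) * hadd c d := by gcongr
    _ = m * ((c⁻¹ + d⁻¹) * (c⁻¹ + d⁻¹)⁻¹) := by rw [← mul_add, mul_assoc, hadd]
    _ ≤ m := by
      rw [ENNReal.mul_inv_cancel (by simp [hc']) (by simp [hc, hd]), mul_one]

lemma toReal_pos_of_pos (hp : 0 < p) (h : p ≠ ∞) : 0 < p.toReal := ENNReal.toReal_pos hp.ne' h

lemma rpow_mul_rpow_one_div {t : ℝ} (ht : 0 < t) (x c : ℝ≥0∞) :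
    x ^ (1 / t) * c = (x * c ^ t) ^ (1 / t) := by
  rw [ENNReal.mul_rpow_of_nonneg _ _ (by positivity), ← ENNReal.rpow_mul,
    mul_one_div_cancel ht.ne', ENNReal.rpow_one]

lemma padd_mul (hp : 0 < p) : padd p a b * c = padd p (a * c) (b * c) := by
  unfold padd
  split_ifs with h
  · exact max_mul_of_nonneg _ _ zero_le
  · have ht := toReal_pos_of_pos hp h
    rw [rpow_mul_rpow_one_div ht, add_mul, ENNReal.mul_rpow_of_nonneg _ _ ht.le,
      ENNReal.mul_rpow_of_nonneg _ _ ht.le]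

lemma pcoadd_mul_le (hp : 0 < p) : pcoadd p a b * c ≤ pcoadd p (a * c) (b * c) := by
  unfold pcoadd
  split_ifs with h
  · exact le_min (mul_le_mul' (min_le_left _ _) le_rfl) (mul_le_mul' (min_le_right _ _) le_rfl)
  · have ht := toReal_pos_of_pos hp h
    rw [rpow_mul_rpow_one_div ht, ENNReal.mul_rpow_of_nonneg _ _ ht.le,
      ENNReal.mul_rpow_of_nonneg _ _ ht.le]
    exact ENNReal.rpow_le_rpow hadd_mul_le (by positivity)

/-- The inequality that eliminates a cut between a soft disjunction and a soft conjunction. -/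
lemma padd_mul_pcoadd_le (hp : 0 < p) :
    padd p a b * pcoadd p c d ≤ max (a * c) (b * d) := by
  unfold padd pcoadd
  split_ifs with h
  · rcases le_total a b with hab | hab
    · rw [max_eq_right hab]
      exact (mul_le_mul' le_rfl (min_le_right _ _)).trans (le_max_right _ _)
    · rw [max_eq_left hab]
      exact (mul_le_mul' le_rfl (min_le_left _ _)).trans (le_max_left _ _)
  · have ht := toReal_pos_of_pos hp h
    rw [← ENNReal.mul_rpow_of_nonneg _ _ (by positivity), one_div,
      ENNReal.rpow_inv_le_iff ht]
    refine add_mul_hadd_le.trans (max_le ?_ ?_) <;>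
      rw [← ENNReal.mul_rpow_of_nonneg _ _ ht.le]
    · exact ENNReal.rpow_le_rpow (le_max_left _ _) ht.le
    · exact ENNReal.rpow_le_rpow (le_max_right _ _) ht.le

end Arithmetic

/-! ### The one-sided cut-free calculus -/

@[simp] lemma Formula.neg_neg (A : Formula V) : A.neg.neg = A := by
  induction A <;> simp_all [Formula.neg]

/-- `CutFree p Δ r`: the one-sided sequent `⊢ Δ` has a cut-free proof of validity `r`. -/
inductive CutFree (p : ℝ≥0∞) : Multiset (Formula V) → ℝ≥0∞ → Prop
  | ax (A : Formula V) : CutFree p {A, A.neg} 1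
  | emp : CutFree p 0 1
  | efq (Γ) : CutFree p Γ 0
  -- Nonemptiness makes both premises strictly smaller than the conclusion, as the finiteness
  -- argument requires.
  | mix {Γ Δ r s} : Γ ≠ 0 → Δ ≠ 0 → CutFree p Γ r → CutFree p Δ s → CutFree p (Γ + Δ) (r * s)
  | one : CutFree p {.one} 1
  | top (Γ) : CutFree p (.top ::ₘ Γ) ∞
  | par {A B Γ r} : CutFree p (A ::ₘ B ::ₘ Γ) r → CutFree p (.par A B ::ₘ Γ) r
  | tensor {A B Γ Δ r s} : CutFree p (A ::ₘ Γ) r → CutFree p (B ::ₘ Δ) s →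
      CutFree p (.tensor A B ::ₘ (Γ + Δ)) (r * s)
  | por {A B Γ r s} : CutFree p (A ::ₘ Γ) r → CutFree p (B ::ₘ Γ) s →
      CutFree p (.por A B ::ₘ Γ) (padd p r s)
  | pand {A B Γ r s} : CutFree p (A ::ₘ Γ) r → CutFree p (B ::ₘ Γ) s →
      CutFree p (.pand A B ::ₘ Γ) (pcoadd p r s)

/-- `Principal p A Γ r`: the sequent `⊢ A, Γ` has a cut-free proof of validity `r` that ends with
a logical rule introducing `A`. -/
inductive Principal (p : ℝ≥0∞) : Formula V → Multiset (Formula V) → ℝ≥0∞ → Prop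
  | one : Principal p .one 0 1
  | top (Γ) : Principal p .top Γ ∞
  | par {A B Γ r} : CutFree p (A ::ₘ B ::ₘ Γ) r → Principal p (.par A B) Γ r
  | tensor {A B Γ Δ r s} : CutFree p (A ::ₘ Γ) r → CutFree p (B ::ₘ Δ) s →
      Principal p (.tensor A B) (Γ + Δ) (r * s)
  | por {A B Γ r s} : CutFree p (A ::ₘ Γ) r → CutFree p (B ::ₘ Γ) s →
      Principal p (.por A B) Γ (padd p r s)
  | pand {A B Γ r s} : CutFree p (A ::ₘ Γ) r → CutFree p (B ::ₘ Γ) s →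
      Principal p (.pand A B) Γ (pcoadd p r s)

/-- `Attains p Γ r`: the sequent `⊢ Γ` has a cut-free proof of validity at least `r`. -/
def Attains (p : ℝ≥0∞) (Γ : Multiset (Formula V)) (r : ℝ≥0∞) : Prop :=
  ∃ t, r ≤ t ∧ CutFree p Γ t

lemma CutFree.attains {Γ : Multiset (Formula V)} {r : ℝ≥0∞} (h : CutFree p Γ r) :
    Attains p Γ r := ⟨r, le_rfl, h⟩

/-- Only `emp` and `efq` can conclude the empty sequent. This is what makes a mix with an empty
premise dispensable. -/
lemma CutFree.le_one {Γ : Multiset (Formula V)} {r : ℝ≥0∞} (h : CutFree p Γ r) (hΓ : Γ = 0) :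
    r ≤ 1 := by
  cases h <;> simp_all

lemma CutFree.principal {A : Formula V} {Γ : Multiset (Formula V)} {r : ℝ≥0∞}
    (h : Principal p A Γ r) : CutFree p (A ::ₘ Γ) r := by
  cases h with
  | one => exact .one
  | top => exact .top _
  | par h => exact .par h
  | tensor h₁ h₂ => exact .tensor h₁ h₂
  | por h₁ h₂ => exact .por h₁ h₂
  | pand h₁ h₂ => exact .pand h₁ h₂

namespace Attains

variable {A B : Formula V} {Γ Δ : Multiset (Formula V)} {r s : ℝ≥0∞}

lemma mono (h : Attains p Γ r) (hs : s ≤ r) : Attains p Γ s :=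
  let ⟨t, ht, h⟩ := h
  ⟨t, hs.trans ht, h⟩

lemma congr (h : Attains p Γ r) (hΓ : Γ = Δ) (hs : r = s) : Attains p Δ s := hΓ ▸ hs ▸ h

lemma zero (Γ : Multiset (Formula V)) : Attains p Γ 0 := (CutFree.efq Γ).attains

lemma mix (h₁ : Attains p Γ r) (h₂ : Attains p Δ s) : Attains p (Γ + Δ) (r * s) := by
  obtain ⟨t, ht, h₁⟩ := h₁
  obtain ⟨t', ht', h₂⟩ := h₂
  rcases eq_or_ne Γ 0 with hΓ | hΓ
  · refine ⟨t', ?_, by simpa [hΓ] using h₂⟩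
    calc r * s ≤ 1 * t' := mul_le_mul' (ht.trans (h₁.le_one hΓ)) ht'
      _ = t' := one_mul _
  rcases eq_or_ne Δ 0 with hΔ | hΔ
  · refine ⟨t, ?_, by simpa [hΔ] using h₁⟩
    calc r * s ≤ t * 1 := mul_le_mul' ht (ht'.trans (h₂.le_one hΔ))
      _ = t := mul_one _
  · exact ⟨_, mul_le_mul' ht ht', .mix hΓ hΔ h₁ h₂⟩

lemma par : Attains p (A ::ₘ B ::ₘ Γ) r → Attains p (.par A B ::ₘ Γ) r :=
  fun ⟨t, ht, h⟩ => ⟨t, ht, .par h⟩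

lemma tensor : Attains p (A ::ₘ Γ) r → Attains p (B ::ₘ Δ) s →
    Attains p (.tensor A B ::ₘ (Γ + Δ)) (r * s) :=
  fun ⟨_, ht, h⟩ ⟨_, ht', h'⟩ => ⟨_, mul_le_mul' ht ht', .tensor h h'⟩

lemma por : Attains p (A ::ₘ Γ) r → Attains p (B ::ₘ Γ) s →
    Attains p (.por A B ::ₘ Γ) (padd p r s) :=
  fun ⟨_, ht, h⟩ ⟨_, ht', h'⟩ => ⟨_, padd_mono ht ht', .por h h'⟩

lemma pand : Attains p (A ::ₘ Γ) r → Attains p (B ::ₘ Γ) s →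
    Attains p (.pand A B ::ₘ Γ) (pcoadd p r s) :=
  fun ⟨_, ht, h⟩ ⟨_, ht', h'⟩ => ⟨_, pcoadd_mono ht ht', .pand h h'⟩

end Attains

/-! ### Cut elimination -/

/-- Permutation of a cut upwards in its first premise: it suffices to cut against proofs whose last
rule introduces the cut formula. -/
lemma CutFree.cut_of_principal (hp : 0 < p) {A : Formula V} {Δ : Multiset (Formula V)} {s : ℝ≥0∞}
    (hs : Attains p (A.neg ::ₘ Δ) s)
    (H : ∀ Γ r, Principal p A Γ r → Attains p (Γ + Δ) (r * s))
    {Ξ₀ : Multiset (Formula V)} {r : ℝ≥0∞} (h : CutFree p Ξ₀ r) :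
    ∀ Γ, Ξ₀ = A ::ₘ Γ → Attains p (Γ + Δ) (r * s) := by
  induction h with
  | ax B =>
    intro Γ hΓ
    -- Whichever side of the axiom is cut, the result is the second premise itself.
    rcases (Multiset.cons_eq_cons).1 hΓ with ⟨rfl, rfl⟩ | ⟨-, Θ, h₁, rfl⟩
    · exact hs.congr (by simp) (by simp)
    · obtain ⟨rfl, rfl⟩ : B.neg = A ∧ Θ = 0 := (Multiset.singleton_eq_cons_iff _).1 h₁
      exact hs.congr (by simp) (by simp)
  | emp => intro Γ hΓ; simp at hΓ
  | efq => intro Γ _; simpa using Attains.zero _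
  | @mix Γ₁ Γ₂ r₁ r₂ _ _ h₁ h₂ ih₁ ih₂ =>
    intro Γ hΓ
    have hA : A ∈ Γ₁ + Γ₂ := hΓ ▸ mem_cons_self _ _
    rcases Multiset.mem_add.1 hA with hA | hA <;> obtain ⟨Θ, rfl⟩ := exists_cons_of_mem hA
    · obtain rfl : Θ + Γ₂ = Γ := by simpa using hΓ
      exact ((ih₁ Θ rfl).mix h₂.attains).congr (by abel) (by ring)
    · obtain rfl : Γ₁ + Θ = Γ := by simpa using hΓ
      exact (h₁.attains.mix (ih₂ Θ rfl)).congr (by abel) (by ring)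
  | one =>
    intro Γ hΓ
    obtain ⟨rfl, rfl⟩ : .one = A ∧ Γ = 0 := (Multiset.singleton_eq_cons_iff _).1 hΓ
    exact H _ _ .one
  | top Θ =>
    intro Γ hΓ
    rcases (Multiset.cons_eq_cons).1 hΓ with ⟨rfl, rfl⟩ | ⟨-, Θ, rfl, rfl⟩
    · exact H _ _ (.top _)
    · exact (CutFree.top (Θ + Δ)).attains.congr (by simp) rfl |>.mono le_top
  | @par B C _ _ h ih =>
    intro Γ hΓ
    rcases (Multiset.cons_eq_cons).1 hΓ with ⟨rfl, rfl⟩ | ⟨-, Θ, rfl, rfl⟩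
    · exact H _ _ (.par h)
    · rw [cons_add]
      refine Attains.par ((ih (B ::ₘ C ::ₘ Θ) ?_).congr (by simp) rfl)
      rw [cons_swap A, cons_swap A]
  | @tensor B C Γ₁ Γ₂ r₁ r₂ h₁ h₂ ih₁ ih₂ =>
    intro Γ hΓ
    rcases (Multiset.cons_eq_cons).1 hΓ with ⟨rfl, rfl⟩ | ⟨-, Θ, hΘ, rfl⟩
    · exact H _ _ (.tensor h₁ h₂)
    rw [cons_add]
    have hA : A ∈ Γ₁ + Γ₂ := hΘ ▸ mem_cons_self _ _
    rcases Multiset.mem_add.1 hA with hA | hA <;> obtain ⟨Ξ, rfl⟩ := exists_cons_of_mem hA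
    · obtain rfl : Ξ + Γ₂ = Θ := by simpa using hΘ
      have := ih₁ (B ::ₘ Ξ) (cons_swap _ _ _)
      rw [cons_add] at this
      exact (this.tensor h₂.attains).congr (by congr 1; abel) (by ring)
    · obtain rfl : Γ₁ + Ξ = Θ := by simpa using hΘ
      have := ih₂ (C ::ₘ Ξ) (cons_swap _ _ _)
      rw [cons_add] at this
      exact (h₁.attains.tensor this).congr (by congr 1; abel) (by ring)
  | @por B C _ _ _ h₁ h₂ ih₁ ih₂ =>
    intro Γ hΓ
    rcases (Multiset.cons_eq_cons).1 hΓ with ⟨rfl, rfl⟩ | ⟨-, Θ, rfl, rfl⟩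
    · exact H _ _ (.por h₁ h₂)
    · have h₁ := ih₁ (B ::ₘ Θ) (cons_swap _ _ _)
      have h₂ := ih₂ (C ::ₘ Θ) (cons_swap _ _ _)
      rw [cons_add] at h₁ h₂ ⊢
      -- The second premise is copied into both branches; homogeneity of the p-sum keeps the
      -- validity unchanged.
      rw [padd_mul hp]
      exact h₁.por h₂
  | @pand B C _ _ _ h₁ h₂ ih₁ ih₂ =>
    intro Γ hΓ
    rcases (Multiset.cons_eq_cons).1 hΓ with ⟨rfl, rfl⟩ | ⟨-, Θ, rfl, rfl⟩
    · exact H _ _ (.pand h₁ h₂)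
    · have h₁ := ih₁ (B ::ₘ Θ) (cons_swap _ _ _)
      have h₂ := ih₂ (C ::ₘ Θ) (cons_swap _ _ _)
      rw [cons_add] at h₁ h₂ ⊢
      exact (h₁.pand h₂).mono (pcoadd_mul_le hp)

/-- A cut may be eliminated once all the cuts between two proofs that introduce the cut formula
can be. -/
lemma Attains.cut_of_principal (hp : 0 < p) {A : Formula V}
    (H : ∀ Γ Δ r s, Principal p A Γ r → Principal p A.neg Δ s → Attains p (Γ + Δ) (r * s))
    {Γ Δ : Multiset (Formula V)} {r s : ℝ≥0∞} (h₁ : Attains p (A ::ₘ Γ) r)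
    (h₂ : Attains p (A.neg ::ₘ Δ) s) : Attains p (Γ + Δ) (r * s) := by
  obtain ⟨r', hr, h₁⟩ := h₁
  obtain ⟨s', hs, h₂⟩ := h₂
  refine Attains.mono ?_ (mul_le_mul' hr hs)
  refine h₁.cut_of_principal hp h₂.attains (fun Γ r hP => ?_) Γ rfl
  -- Second pass, with the roles of `A` and `A.neg` exchanged: the first premise is now principal,
  -- and the second is permuted upwards.
  have := h₂.cut_of_principal (A := A.neg) (Δ := Γ) (s := r) hp
    (by simpa using (CutFree.principal hP).attains)
    (fun Δ s hQ => (H Γ Δ r s hP hQ).congr (add_comm _ _) (mul_comm _ _)) Δ rfl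
  exact this.congr (add_comm _ _) (mul_comm _ _)

/-- Induction on the cut formula, reduced to principal cuts. Atoms and `bot` have no introduction
rule, so their cases, and that of `top` by duality, are vacuous. -/
theorem Attains.cut (hp : 0 < p) (A : Formula V) {Γ Δ : Multiset (Formula V)} {r s : ℝ≥0∞}
    (h₁ : Attains p (A ::ₘ Γ) r) (h₂ : Attains p (A.neg ::ₘ Δ) s) :
    Attains p (Γ + Δ) (r * s) := by
  induction A generalizing Γ Δ r s with
  | atom a => exact .cut_of_principal hp (fun _ _ _ _ hP _ => by cases hP) h₁ h₂
  | natom a => exact .cut_of_principal hp (fun _ _ _ _ hP _ => by cases hP) h₁ h₂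
  | bot => exact .cut_of_principal hp (fun _ _ _ _ hP _ => by cases hP) h₁ h₂
  | top => exact .cut_of_principal hp (fun _ _ _ _ _ hQ => by cases hQ) h₁ h₂
  | one =>
    refine .cut_of_principal hp (fun _ _ _ _ hP hQ => ?_) h₁ h₂
    cases hP
    cases hQ
    exact CutFree.emp.attains.congr (by simp) (by simp)
  | tensor A B ihA ihB =>
    refine .cut_of_principal hp (fun _ Δ _ _ hP hQ => ?_) h₁ h₂
    cases hP with | @tensor _ _ Γ₁ Γ₂ r₁ r₂ hA hB =>
    cases hQ with | par h =>
    -- A principal multiplicative cut becomes two successive cuts, on `A` and then on `B`.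
    have h' := ihA hA.attains h.attains
    rw [add_cons] at h'
    exact (ihB hB.attains h').congr (by abel) (by ring)
  | par A B ihA ihB =>
    refine .cut_of_principal hp (fun Γ _ _ _ hP hQ => ?_) h₁ h₂
    cases hQ with | tensor hA hB =>
    cases hP with | par h =>
    have h' := ihA h.attains hA.attains
    rw [cons_add] at h'
    exact (ihB h' hB.attains).congr (by abel) (by ring)
  | por A B ihA ihB =>
    refine .cut_of_principal hp (fun _ _ _ _ hP hQ => ?_) h₁ h₂
    cases hP with | @por _ _ _ a b hA hB =>
    cases hQ with | @pand _ _ _ c d hA' hB' =>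
    refine .mono ?_ (padd_mul_pcoadd_le hp)
    -- Only the cut on the component with the larger product is kept.
    rcases max_choice (a * c) (b * d) with hm | hm <;> rw [hm]
    · exact ihA hA.attains hA'.attains
    · exact ihB hB.attains hB'.attains
  | pand A B ihA ihB =>
    refine .cut_of_principal hp (fun _ _ _ _ hP hQ => ?_) h₁ h₂
    cases hP with | @pand _ _ _ a b hA hB =>
    cases hQ with | @por _ _ _ c d hA' hB' =>
    refine .mono (r := max (c * a) (d * b)) ?_
      ((mul_comm _ _).trans_le (padd_mul_pcoadd_le hp))
    rcases max_choice (c * a) (d * b) with hm | hm <;> rw [hm]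
    · exact (ihA hA.attains hA'.attains).congr rfl (mul_comm _ _)
    · exact (ihB hB.attains hB'.attains).congr rfl (mul_comm _ _)

/-! ### Soundness of the one-sided calculus for derivations -/

/-- The one-sided form of a sequent. -/
def Sequent.oneSided (s : Sequent (Formula V)) : Multiset (Formula V) :=
  s.ant.map Formula.neg + s.succ

/-- `K.Attains p r`: replacing sequents by validities of cut-free proofs of them, the structure
`K` takes a value at least `r`. -/
def Structure.Attains (p : ℝ≥0∞) : Structure (Formula V) → ℝ≥0∞ → Prop
  | .seq s, r => QLL.Attains p s.oneSided r
  | .val t, r => r ≤ t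
  | .op c H K, r => ∃ a b, H.Attains p a ∧ K.Attains p b ∧ r ≤ c.interp p a b

lemma Structure.Attains.mono {K : Structure (Formula V)} {r s : ℝ≥0∞} (h : K.Attains p r)
    (hs : s ≤ r) : K.Attains p s := by
  cases K with
  | seq => exact QLL.Attains.mono h hs
  | val => exact hs.trans h
  | op c H K =>
    obtain ⟨a, b, ha, hb, h⟩ := h
    exact ⟨a, b, ha, hb, hs.trans h⟩

lemma Structure.attains_eval (K : Structure (Formula V)) (hK : K.IsClosed) :
    K.Attains p (K.eval p hK) := by
  induction K with
  | seq => exact hK.elim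
  | val => exact le_rfl
  | op c H K ihH ihK => exact ⟨_, _, ihH hK.1, ihK hK.2, le_rfl⟩

/-- In one-sided form a left rule is the right rule of the dual connective, and the negation rules
do nothing; cut is the only rule needing cut elimination. -/
lemma PQLL.attains (hp : 0 < p) {H K : Structure (Formula V)} (R : PQLL V H K) {r : ℝ≥0∞}
    (h : H.Attains p r) : K.Attains p r := by
  cases R with
  | ax A =>
    exact (CutFree.ax A).attains.mono h |>.congr
      (Multiset.pair_comm _ _) rfl
  | emp => exact CutFree.emp.attains.mono h
  | efq Γ Δ => exact (Attains.zero _).mono h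
  | cut Γ Γ' Δ Δ' A =>
    obtain ⟨a, b, ha, hb, h⟩ := h
    simp only [Structure.Attains, Sequent.oneSided, map_cons, cons_add, add_cons] at ha hb
    exact ((ha.cut hp A hb).mono h).congr (by simp [Sequent.oneSided]; abel) rfl
  | mix Γ Γ' Δ Δ' =>
    obtain ⟨a, b, ha, hb, h⟩ := h
    exact ((ha.mix hb).mono h).congr (by simp [Sequent.oneSided]; abel) rfl
  | tensorL Γ Δ A B =>
    simp only [Structure.Attains, Sequent.oneSided, map_cons, cons_add] at h ⊢
    exact h.par
  | parR Γ Δ A B =>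
    simp only [Structure.Attains, Sequent.oneSided, add_cons] at h ⊢
    exact h.par
  | parL Γ Γ' Δ Δ' A B =>
    obtain ⟨a, b, ha, hb, h⟩ := h
    simp only [Structure.Attains, Sequent.oneSided, map_cons, cons_add] at ha hb
    exact ((ha.tensor hb).mono h).congr
      (by simp only [Sequent.oneSided, map_cons, Multiset.map_add, cons_add]
          exact congrArg _ (by abel)) rfl
  | tensorR Γ Γ' Δ Δ' A B =>
    obtain ⟨a, b, ha, hb, h⟩ := h
    simp only [Structure.Attains, Sequent.oneSided, add_cons] at ha hb
    exact ((ha.tensor hb).mono h).congr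
      (by simp only [Sequent.oneSided, add_cons, Multiset.map_add]
          exact congrArg _ (by abel)) rfl
  | oneL => exact CutFree.one.attains.mono h
  | oneR => exact CutFree.one.attains.mono h
  | negL Γ Δ A => exact QLL.Attains.congr h (by simp [Sequent.oneSided]) rfl
  | negR Γ Δ A => exact QLL.Attains.congr h (by simp [Sequent.oneSided]) rfl
  | porL Γ Δ A B =>
    obtain ⟨a, b, ha, hb, h⟩ := h
    simp only [Structure.Attains, Sequent.oneSided, map_cons, cons_add] at ha hb ⊢
    exact (ha.pand hb).mono h
  | pandR Γ Δ A B =>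
    obtain ⟨a, b, ha, hb, h⟩ := h
    simp only [Structure.Attains, Sequent.oneSided, add_cons] at ha hb ⊢
    exact (ha.pand hb).mono h
  | pandL Γ Δ A B =>
    obtain ⟨a, b, ha, hb, h⟩ := h
    simp only [Structure.Attains, Sequent.oneSided, map_cons, cons_add] at ha hb ⊢
    exact (ha.por hb).mono h
  | porR Γ Δ A B =>
    obtain ⟨a, b, ha, hb, h⟩ := h
    simp only [Structure.Attains, Sequent.oneSided, add_cons] at ha hb ⊢
    exact (ha.por hb).mono h
  | botL Γ Δ =>
    simp only [Structure.Attains, Sequent.oneSided, map_cons, cons_add] at h ⊢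
    exact (CutFree.top _).attains.mono h
  | topR Γ Δ =>
    simp only [Structure.Attains, Sequent.oneSided, add_cons] at h ⊢
    exact (CutFree.top _).attains.mono h

/-- The witnesses in `Structure.Attains` let side-by-side composition act on each component while
keeping its value, so no monotonicity of the connectives is needed. -/
lemma Derivation.attains (hp : 0 < p) {H K : Structure (Formula V)} (d : Derivation (PQLL V) H K)
    {r : ℝ≥0∞} (h : H.Attains p r) : K.Attains p r := by
  induction d generalizing r with
  | id => exact h
  | rule R => exact R.attains hp h
  | comp _ _ ih₁ ih₂ => exact ih₂ (ih₁ h)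
  | op c _ _ ih₁ ih₂ =>
    obtain ⟨a, b, ha, hb, h⟩ := h
    exact ⟨a, b, ih₁ ha, ih₂ hb, h⟩

lemma ClosedDerivation.attains (hp : 0 < p) {K : Structure (Formula V)}
    (d : ClosedDerivation (PQLL V) K) : K.Attains p (d.validity p) :=
  d.derivation.attains hp (d.top.attains_eval d.closed)

/-! ### Cut-free proofs as derivations -/

/-- `HasProof p Γ Δ r`: the sequent with cedents `Γ` and `Δ` has a proof of validity `r`. -/
def HasProof (p : ℝ≥0∞) (Γ Δ : Multiset (Formula V)) (r : ℝ≥0∞) : Prop :=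
  ∃ π : Proof (PQLL V) ⟨Γ, Δ⟩, π.validity p = r

namespace HasProof

variable {Γ Γ₁ Γ₂ Δ Δ₁ Δ₂ : Multiset (Formula V)} {r s : ℝ≥0∞}

lemma axm (R : PQLL V (.val r) (Γ ⊢ₛ Δ)) : HasProof p Γ Δ r :=
  ⟨⟨.val r, trivial, .rule R⟩, rfl⟩

lemma unary (R : PQLL V (Γ₁ ⊢ₛ Δ₁) (Γ ⊢ₛ Δ)) : HasProof p Γ₁ Δ₁ r → HasProof p Γ Δ r
  | ⟨π, h⟩ => ⟨⟨π.top, π.closed, .comp π.derivation (.rule R)⟩, h⟩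

lemma binary (c : Conn) (R : PQLL V (.op c (Γ₁ ⊢ₛ Δ₁) (Γ₂ ⊢ₛ Δ₂)) (Γ ⊢ₛ Δ)) :
    HasProof p Γ₁ Δ₁ r → HasProof p Γ₂ Δ₂ s → HasProof p Γ Δ (c.interp p r s)
  | ⟨π, h⟩, ⟨π', h'⟩ =>
    ⟨⟨.op c π.top π'.top, ⟨π.closed, π'.closed⟩,
      .comp (.op c π.derivation π'.derivation) (.rule R)⟩, h ▸ h' ▸ rfl⟩

lemma of_cutFree (h : CutFree p Δ r) : HasProof p 0 Δ r := by
  induction h with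
  | ax A =>
    rw [Multiset.pair_comm]
    exact unary (.negR 0 {A} A) (axm (.ax A))
  | emp => exact axm .emp
  | efq Γ => exact axm (.efq 0 Γ)
  | mix _ _ _ _ ih₁ ih₂ => exact binary .tensor (.mix 0 0 _ _) ih₁ ih₂
  | one => exact axm .oneR
  | top Γ => exact axm (.topR 0 Γ)
  | par _ ih => exact unary (.parR _ _ _ _) ih
  | tensor _ _ ih₁ ih₂ => exact binary .tensor (.tensorR 0 0 _ _ _ _) ih₁ ih₂
  | por _ _ ih₁ ih₂ => exact binary .padd (.porR _ _ _ _) ih₁ ih₂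
  | pand _ _ ih₁ ih₂ => exact binary .pcoadd (.pandR _ _ _ _) ih₁ ih₂

lemma of_oneSided (h : HasProof p 0 (Sequent.oneSided ⟨Γ, Δ⟩) r) : HasProof p Γ Δ r := by
  induction Γ using Multiset.induction_on generalizing Δ with
  | empty => simpa [Sequent.oneSided] using h
  | cons A Γ ih =>
    -- Negating `A.neg` on its way to the left restores `A`, since negation is involutive.
    have := unary (.negL Γ Δ A.neg) (ih (Δ := A.neg ::ₘ Δ) (by simpa [Sequent.oneSided] using h))
    rwa [Formula.neg_neg] at this

end HasProof

/-! ### Finiteness of the validities of cut-free proofs -/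

/-- The number of nodes of a formula. -/
def Formula.size : Formula V → ℕ
  | .atom _ | .natom _ | .one | .bot | .top => 1
  | .tensor A B | .par A B | .por A B | .pand A B => A.size + B.size + 1

lemma Formula.size_pos (A : Formula V) : 0 < A.size := by
  cases A <;> simp [Formula.size]

/-- The total size of a multiset of formulae. -/
def msize (Γ : Multiset (Formula V)) : ℕ := (Γ.map Formula.size).sum

@[simp] lemma msize_cons (A : Formula V) (Γ : Multiset (Formula V)) :
    msize (A ::ₘ Γ) = A.size + msize Γ := by simp [msize]

@[simp] lemma msize_add (Γ Δ : Multiset (Formula V)) : msize (Γ + Δ) = msize Γ + msize Δ := by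
  simp [msize]

lemma msize_pos {Γ : Multiset (Formula V)} (h : Γ ≠ 0) : 0 < msize Γ := by
  obtain ⟨A, hA⟩ := exists_mem_of_ne_zero h
  obtain ⟨Δ, rfl⟩ := exists_cons_of_mem hA
  have := A.size_pos
  rw [msize_cons]
  omega

/-- The pairs of multisets with a given sum form a finite set. -/
lemma finite_add_eq {α : Type*} (Γ : Multiset α) :
    {x : Multiset α × Multiset α | x.1 + x.2 = Γ}.Finite := by
  classical
  exact (Γ.antidiagonal.toFinset.finite_toSet).subset fun x hx => by simpa using hx

/-- The occurrences of formulae in a multiset form a finite set. -/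
lemma finite_cons_eq {α : Type*} (Γ : Multiset α) :
    {x : α × Multiset α | x.1 ::ₘ x.2 = Γ}.Finite := by
  refine ((finite_add_eq Γ).preimage (f := fun x : α × Multiset α => ({x.1}, x.2)) ?_).subset
    fun x hx => by simpa using hx
  rintro ⟨a, s⟩ - ⟨b, t⟩ - h
  simpa using h

/-- The validities of the cut-free proofs ending with a logical rule are finite in number if those
of the proofs of smaller sequents are. -/
lemma finite_principal {A : Formula V} {Γ : Multiset (Formula V)}
    (ih : ∀ Δ : Multiset (Formula V), msize Δ < msize (A ::ₘ Γ) → {r | CutFree p Δ r}.Finite) :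
    {r | Principal p A Γ r}.Finite := by
  cases A with
  | atom a => exact Set.finite_empty.subset fun r h => by cases h
  | natom a => exact Set.finite_empty.subset fun r h => by cases h
  | bot => exact Set.finite_empty.subset fun r h => by cases h
  | one => exact (Set.finite_singleton 1).subset fun r h => by cases h; rfl
  | top => exact (Set.finite_singleton ∞).subset fun r h => by cases h; rfl
  | par A B =>
    refine (ih (A ::ₘ B ::ₘ Γ) (by simp [Formula.size]; omega)).subset fun r h => ?_
    cases h with | par h => exact h
  | por A B =>
    refine ((ih (A ::ₘ Γ) (by simp only [msize_cons, Formula.size]; omega)).image2 (padd p)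
      (ih (B ::ₘ Γ) (by simp only [msize_cons, Formula.size]; omega))).subset fun r h => ?_
    cases h with | por h₁ h₂ => exact ⟨_, h₁, _, h₂, rfl⟩
  | pand A B =>
    refine ((ih (A ::ₘ Γ) (by simp only [msize_cons, Formula.size]; omega)).image2 (pcoadd p)
      (ih (B ::ₘ Γ) (by simp only [msize_cons, Formula.size]; omega))).subset fun r h => ?_
    cases h with | pand h₁ h₂ => exact ⟨_, h₁, _, h₂, rfl⟩
  | tensor A B =>
    -- The context splits between the premises in finitely many ways.
    refine ((finite_add_eq Γ).biUnion (t := fun x => Set.image2 (· * ·)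
      {r | CutFree p (A ::ₘ x.1) r} {r | CutFree p (B ::ₘ x.2) r}) ?_).subset fun r h => ?_
    · rintro ⟨Γ₁, Γ₂⟩ rfl
      exact (ih _ (by simp [Formula.size]; omega)).image2 _ (ih _ (by simp [Formula.size]; omega))
    · cases h with | @tensor _ _ Γ₁ Γ₂ _ _ h₁ h₂ =>
      exact Set.mem_biUnion (x := (Γ₁, Γ₂)) rfl ⟨_, h₁, _, h₂, rfl⟩

/-- Strong induction on total size: a sequent has finitely many decompositions by a last rule, and
every premise is smaller. Additive rules copy the context, but each premise separately still loses a
connective. -/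
theorem finite_cutFree (p : ℝ≥0∞) (Γ : Multiset (Formula V)) : {r | CutFree p Γ r}.Finite := by
  induction hn : msize Γ using Nat.strong_induction_on generalizing Γ with
  | _ n ih =>
  subst hn
  have hmix : (⋃ x ∈ {x : Multiset (Formula V) × Multiset (Formula V) | x.1 + x.2 = Γ},
      {r | x.1 ≠ 0 ∧ x.2 ≠ 0 ∧ ∃ a b, CutFree p x.1 a ∧ CutFree p x.2 b ∧ a * b = r}).Finite := by
    refine (finite_add_eq Γ).biUnion ?_
    rintro ⟨Γ₁, Γ₂⟩ rfl
    by_cases h : Γ₁ ≠ 0 ∧ Γ₂ ≠ 0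
    · have h₁ := msize_pos h.1
      have h₂ := msize_pos h.2
      refine ((ih _ (by simp; omega) Γ₁ rfl).image2 (· * ·)
        (ih _ (by simp; omega) Γ₂ rfl)).subset ?_
      rintro r ⟨-, -, a, b, ha, hb, rfl⟩
      exact ⟨a, ha, b, hb, rfl⟩
    · exact Set.finite_empty.subset fun r hr => h ⟨hr.1, hr.2.1⟩
  have hprin : (⋃ x ∈ {x : Formula V × Multiset (Formula V) | x.1 ::ₘ x.2 = Γ},
      {r | Principal p x.1 x.2 r}).Finite := by
    refine (finite_cons_eq Γ).biUnion ?_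
    rintro ⟨A, Γ⟩ rfl
    exact finite_principal fun Δ hΔ => ih _ hΔ Δ rfl
  have hlog : ∀ {A : Formula V} {Δ : Multiset (Formula V)} {r : ℝ≥0∞}, Principal p A Δ r →
      A ::ₘ Δ = Γ → r ∈ ⋃ x ∈ {x : Formula V × Multiset (Formula V) | x.1 ::ₘ x.2 = Γ},
        {r | Principal p x.1 x.2 r} :=
    fun {A Δ r} h hΓ => Set.mem_biUnion (x := (A, Δ)) hΓ h
  -- The values `0` and `1` account for `efq`, `ax` and `emp`; the remaining rules are mix or
  -- principal.
  refine (((Set.toFinite ({0, 1} : Set ℝ≥0∞)).union hmix).union hprin).subset fun r hr => ?_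
  have hr : CutFree p Γ r := hr
  cases hr with
  | ax A => simp
  | emp => simp
  | efq => simp
  | @mix Γ₁ Γ₂ a b h₁ h₂ ha hb =>
    exact Or.inl (Or.inr (Set.mem_biUnion (x := (Γ₁, Γ₂)) rfl ⟨h₁, h₂, a, b, ha, hb, rfl⟩))
  | one => exact Or.inr (hlog .one rfl)
  | top Γ => exact Or.inr (hlog (.top Γ) rfl)
  | par h => exact Or.inr (hlog (.par h) rfl)
  | tensor h₁ h₂ => exact Or.inr (hlog (.tensor h₁ h₂) rfl)
  | por h₁ h₂ => exact Or.inr (hlog (.por h₁ h₂) rfl)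
  | pand h₁ h₂ => exact Or.inr (hlog (.pand h₁ h₂) rfl)

end QLL

/-! ### Attainment of the supremum -/

theorem mainTheorem2 {V : Type*} (p : ℝ≥0∞) (hp : 0 < p)
    (Γ Δ : Multiset (QLL.Formula V)) :
    ∃ π : QLL.Proof (QLL.PQLL V) ⟨Γ, Δ⟩,
      π.validity p = QLL.provability p (QLL.PQLL V) ⟨Γ, Δ⟩ := by
  -- The zero-validity proof given by `efq` makes the finite set nonempty, so it has a maximum.
  obtain ⟨m, hm, hmax⟩ := Set.exists_max_image _ id
    (QLL.finite_cutFree p (QLL.Sequent.oneSided ⟨Γ, Δ⟩)) ⟨0, .efq _⟩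
  obtain ⟨π, hπ⟩ := QLL.HasProof.of_oneSided (QLL.HasProof.of_cutFree hm)
  refine ⟨π, le_antisymm (le_iSup (fun π => QLL.ClosedDerivation.validity p π) π)
    (iSup_le fun π' => ?_)⟩
  obtain ⟨t, ht, h⟩ := π'.attains hp
  exact ht.trans ((hmax t h).trans_eq hπ.symm)
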